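/- Let $(\Omega,\mathcal F,\mathbb P)$ be a complete probability space, let $E$ be a separable real Banach space with its Borel $\sigma$-algebra $\mathcal B(E)$ and dual $E^*$, and let $p\in\{0\}\cup[1,\infty)$. Let $L^0(E)$ be the space of all $E$-valued random variables modulo almost sure equality, with the topology of convergence in probability, and for $p\ge 1$ let $L^p(E)$ be the space of those with $\mathbb E|\xi|^p<\infty$, with its norm topology; these topologies are called strong, and $\operatorname{cl}_p$ is the closure in them. A set $A\subseteq L^p(E)$ is *decomposable* if $1_B\xi+1_{B^c}\zeta\in A$ for all $\xi,\zeta\in A$ and $B\in\mathcal F$; $\operatorname{dec}A$ is the smallest decomposable subset of $L^p(E)$ containing $A$. A *closed random set* is a map $X$ from $\Omega$ to the subsets of $E$ with $\{(\omega,x): x\in X(\omega)\}\in\mathcal F\otimes\mathcal B(E)$ and with $X(\omega)$ closed for almost every $\omega$; $L^p(X)$ is the set of $\xi\in L^p(E)$ with $\xi(\omega)\in X(\omega)$ for almost every $\omega$. For nonempty $A\subseteq L^p(E)$, let $F_A$ be the closed random set, unique up to almost sure equality, with $\operatorname{cl}_p\operatorname{dec}A=L^p(F_A)$. A transition probability kernel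 $K$ from $(\Omega,\mathcal F)$ to $(E,\mathcal B(E))$ has *barycenter* $Y\in L^p(E)$ if, for almost every $\omega$, the point $Y(\omega)$ is the barycenter of $K(\omega)$, i.e. for every $L\in E^*$ the integral $\int_E L(x)\,K(\omega,dx)$ exists and equals $L(Y(\omega))$. The set $A$ is *$p$-Choquet convex decomposable* if it contains the barycenter of every transition probability kernel $K$ that has a barycenter in $L^p(E)$ and satisfies $K(\omega,F_A(\omega))=1$ for almost every $\omega$. Let $A$ be a nonempty subset of $L^p(E)$. Then $A$ is $p$-Choquet convex decomposable if and only if $A$ is convex, decomposable and strongly closed. -/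

import Mathlib

open MeasureTheory Filter Topology
open scoped ENNReal

/-! Throughout, `P` is a probability measure on `Ω`, `E` is a separable real Banach space, and
`L^p(E)` is Mathlib's `Lp E p P`. For `p = 0` the space `Lp E 0 P` consists of all classes of
(strongly) measurable functions, i.e. it is `L^0(E)`. -/

namespace ChoquetDecomposition

variable {Ω E : Type*} [MeasurableSpace Ω] [NormedAddCommGroup E] [NormedSpace ℝ E]

/-- The topology of convergence in probability on `L^p(E)`: the sets
`{η | P {ω | ε ≤ ‖η ω - ξ ω‖} < ε}`, `ε > 0`, are a neighbourhood basis of `ξ`. -/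
@[reducible]
def probabilityTopology (E : Type*) [NormedAddCommGroup E] (p : ℝ≥0∞) (P : Measure Ω) :
    TopologicalSpace (Lp E p P) where
  IsOpen U := ∀ ξ ∈ U, ∃ ε : ℝ, 0 < ε ∧
    ∀ η : Lp E p P, P {ω | ε ≤ ‖η ω - ξ ω‖} < ENNReal.ofReal ε → η ∈ U
  isOpen_univ := fun _ _ => ⟨1, one_pos, fun _ _ => trivial⟩
  isOpen_inter := by
    rintro U V hU hV ξ ⟨hξU, hξV⟩
    obtain ⟨ε, hε, h⟩ := hU ξ hξU
    obtain ⟨δ, hδ, h'⟩ := hV ξ hξV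
    refine ⟨min ε δ, lt_min hε hδ, fun η hη => ⟨h η ?_, h' η ?_⟩⟩
    · exact (measure_mono fun ω hω => (min_le_left ε δ).trans hω).trans_lt
        (hη.trans_le (ENNReal.ofReal_le_ofReal (min_le_left ε δ)))
    · exact (measure_mono fun ω hω => (min_le_right ε δ).trans hω).trans_lt
        (hη.trans_le (ENNReal.ofReal_le_ofReal (min_le_right ε δ)))
  isOpen_sUnion := by
    rintro S hS ξ ⟨U, hU, hξ⟩
    obtain ⟨ε, hε, h⟩ := hS U hU ξ hξ
    exact ⟨ε, hε, fun η hη => ⟨U, hU, h η hη⟩⟩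

open Classical in
/-- The strong topology of `L^p(E)`: the norm topology for `p ≥ 1`, and the topology of
convergence in probability for `p = 0`. -/
@[reducible]
noncomputable def strongTopology (E : Type*) [NormedAddCommGroup E] (p : ℝ≥0∞) (P : Measure Ω) :
    TopologicalSpace (Lp E p P) :=
  if h : 1 ≤ p then
    haveI : Fact (1 ≤ p) := ⟨h⟩
    (inferInstance : TopologicalSpace (Lp E p P))
  else probabilityTopology E p P

variable {P : Measure Ω} {p : ℝ≥0∞}

/-- `A` is strongly closed in `L^p(E)`. -/
def IsStronglyClosed (A : Set (Lp E p P)) : Prop :=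
  @IsClosed _ (strongTopology E p P) A

/-- The strong closure `cl_p A`. -/
def strongClosure (A : Set (Lp E p P)) : Set (Lp E p P) :=
  @closure _ (strongTopology E p P) A

/-- `A` is decomposable: `1_B ξ + 1_{Bᶜ} ζ ∈ A` for all `ξ, ζ ∈ A` and measurable `B`
(`η` is the class of that function). -/
def IsDecomposable (A : Set (Lp E p P)) : Prop :=
  ∀ ξ ∈ A, ∀ ζ ∈ A, ∀ B : Set Ω, MeasurableSet B → ∀ η : Lp E p P,
    (∀ᵐ ω ∂P, η ω = B.indicator ξ ω + Bᶜ.indicator ζ ω) → η ∈ A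

/-- The decomposable hull `dec A`, the intersection of all decomposable sets containing `A`. -/
def decHull (A : Set (Lp E p P)) : Set (Lp E p P) :=
  ⋂₀ {D | IsDecomposable D ∧ A ⊆ D}

/-- A closed random set: a multifunction with measurable graph and almost surely closed values. -/
structure IsClosedRandomSet [MeasurableSpace E] (P : Measure Ω) (X : Ω → Set E) : Prop where
  measurableSet_graph : MeasurableSet {z : Ω × E | z.2 ∈ X z.1}
  isClosed : ∀ᵐ ω ∂P, IsClosed (X ω)

/-- `L^p(X)`: the `p`-integrable (almost sure) selections of the multifunction `X`. -/
def selections (p : ℝ≥0∞) (P : Measure Ω) (X : Ω → Set E) : Set (Lp E p P) :=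
  {ξ | ∀ᵐ ω ∂P, ξ ω ∈ X ω}

/-- `F` is (a version of) the closed random set `F_A` determined, uniquely up to almost sure
equality, by `cl_p (dec A) = L^p(F_A)`. -/
def IsDecRandomSet [MeasurableSpace E] (A : Set (Lp E p P)) (F : Ω → Set E) : Prop :=
  IsClosedRandomSet P F ∧ strongClosure (decHull A) = selections p P F

/-- `y` is the barycenter of `μ`: `L y = ∫ L(x) μ(dx)` for every `L` in the dual of `E`, where the
existence of these integrals is part of the requirement. -/
def IsBarycenter [MeasurableSpace E] (μ : Measure E) (y : E) : Prop :=
  ∀ L : E →L[ℝ] ℝ, Integrable (fun x => L x) μ ∧ L y = ∫ x, L x ∂μ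

/-- `Y ∈ L^p(E)` is the barycenter of the transition kernel `K`: for almost every `ω`, the point
`Y ω` is the barycenter of `K ω`. -/
def IsKernelBarycenter [MeasurableSpace E] (K : ProbabilityTheory.Kernel Ω E) (Y : Lp E p P) :
    Prop :=
  ∀ᵐ ω ∂P, IsBarycenter (K ω) (Y ω)

/-- The set `𝒦_p(A)` of transition probability kernels `K` with `K(ω, F_A(ω)) = 1` for almost
every `ω` that have a barycenter in `L^p(E)`. (Every Borel probability measure on a separable
Banach space is regular, so regularity of `K ω` needs no separate clause.) -/
def choquetKernels [MeasurableSpace E] (A : Set (Lp E p P)) :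
    Set (ProbabilityTheory.Kernel Ω E) :=
  {K | ProbabilityTheory.IsMarkovKernel K ∧
    (∃ F : Ω → Set E, IsDecRandomSet A F ∧ ∀ᵐ ω ∂P, K ω (F ω) = 1) ∧
    ∃ Y : Lp E p P, IsKernelBarycenter K Y}

/-- `Y` is a `p`-Choquet convex decomposition of points in `A`. -/
def IsChoquetConvexDecomposition [MeasurableSpace E] (A : Set (Lp E p P)) (Y : Lp E p P) : Prop :=
  ∃ K ∈ choquetKernels A, IsKernelBarycenter K Y

/-- `A` is `p`-Choquet convex decomposable: it contains every `p`-Choquet convex decomposition of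
its elements. -/
def IsChoquetConvexDecomposable [MeasurableSpace E] (A : Set (Lp E p P)) : Prop :=
  ∀ Y : Lp E p P, IsChoquetConvexDecomposition A Y → Y ∈ A

end ChoquetDecomposition

/-! Put `D = cl_p (dec A)`, which equals `L^p(F_A)`. If `A` is Choquet convex decomposable, test it
with the kernels `a δ_ξ + b δ_ζ` for selections `ξ, ζ` of `F_A` (`smul_add_smul_mem`). The case `ξ =
ζ` gives `D ⊆ A`, so `A = D` is closed and decomposable, and general weights give convexity.

Conversely, let `A` be convex, decomposable and closed, so that `A = D`. By `exists_castaing`, `A`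
is the set of selections of `G ω = closure {ξ n ω}` with every `ξ n` in `A`. Convexity of `A` makes
almost every `G ω` convex (`ae_convex_closure_range`). A kernel carried by any version `F` of `F_A`
is carried by `G`: otherwise a measurable selection of `F \ G` on a set of positive measure would
give a selection of `F` that is not one of `G` (`ae_ae_mem_of_selections_subset`). Hahn-Banach then
puts the barycenter of `K ω` in `G ω`, so the barycenter of `K` lies in `A`. -/

namespace ChoquetDecomposition

/-! ### Strong closedness, treated uniformly for `p = 0` and `1 ≤ p`. -/

section StrongTopology

variable {Ω E : Type*} [MeasurableSpace Ω] [NormedAddCommGroup E] {P : Measure Ω} {p : ℝ≥0∞}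

theorem strongTopology_of_one_le [Fact (1 ≤ p)] :
    strongTopology E p P = (inferInstance : TopologicalSpace (Lp E p P)) :=
  dif_pos (Fact.out : 1 ≤ p)

theorem strongTopology_zero : strongTopology E 0 P = probabilityTopology E 0 P :=
  dif_neg (by simp)

theorem isStronglyClosed_iff_isClosed [Fact (1 ≤ p)] {A : Set (Lp E p P)} :
    IsStronglyClosed A ↔ IsClosed A := by
  rw [IsStronglyClosed, strongTopology_of_one_le]

theorem isStronglyClosed_zero_iff {A : Set (Lp E 0 P)} :
    IsStronglyClosed A ↔ ∀ ξ ∉ A, ∃ ε : ℝ, 0 < ε ∧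
      ∀ η : Lp E 0 P, P {ω | ε ≤ ‖η ω - ξ ω‖} < ENNReal.ofReal ε → η ∉ A := by
  rw [IsStronglyClosed, strongTopology_zero, ← @isOpen_compl_iff _ _ (_)]
  rfl

theorem isStronglyClosed_strongClosure (A : Set (Lp E p P)) :
    IsStronglyClosed (strongClosure A) :=
  @isClosed_closure _ (strongTopology E p P) A

theorem subset_strongClosure (A : Set (Lp E p P)) : A ⊆ strongClosure A :=
  @subset_closure _ (strongTopology E p P) A

theorem strongClosure_subset {A B : Set (Lp E p P)} (hB : IsStronglyClosed B) (h : A ⊆ B) :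
    strongClosure A ⊆ B :=
  @closure_minimal _ (strongTopology E p P) A B h hB

/-- The preimage of a strongly closed set under a pointwise nonexpansive map is strongly closed. -/
theorem IsStronglyClosed.preimage_of_nonexpansive (hp : p = 0 ∨ 1 ≤ p)
    {A : Set (Lp E p P)} (hA : IsStronglyClosed A) {T : Lp E p P → Lp E p P}
    (hT : ∀ η ξ, ∀ᵐ ω ∂P, ‖T η ω - T ξ ω‖ ≤ ‖η ω - ξ ω‖) : IsStronglyClosed (T ⁻¹' A) := by
  rcases hp with rfl | hp
  · rw [isStronglyClosed_zero_iff] at hA ⊢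
    intro ξ hξ
    obtain ⟨ε, hε, h⟩ := hA (T ξ) hξ
    refine ⟨ε, hε, fun η hη => h (T η) (lt_of_le_of_lt (measure_mono_ae ?_) hη)⟩
    filter_upwards [hT η ξ] with ω hω using fun h => le_trans h hω
  · have : Fact (1 ≤ p) := ⟨hp⟩
    rw [isStronglyClosed_iff_isClosed] at hA ⊢
    refine hA.preimage (LipschitzWith.of_dist_le_mul (K := 1) fun η ξ => ?_).continuous
    rw [dist_eq_norm, dist_eq_norm, NNReal.coe_one, one_mul]
    apply Lp.norm_le_norm_of_ae_le
    filter_upwards [hT η ξ, Lp.coeFn_sub (T η) (T ξ), Lp.coeFn_sub η ξ] with ω h1 h2 h3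
    rwa [h2, h3]

/-- Strongly closed sets are stable under dominated almost sure convergence. -/
theorem IsStronglyClosed.mem_of_dominated [IsFiniteMeasure P] (hp : p = 0 ∨ (1 ≤ p ∧ p ≠ ∞))
    {A : Set (Lp E p P)} (hA : IsStronglyClosed A) {η : ℕ → Lp E p P} (hη : ∀ n, η n ∈ A)
    {ξ ζ : Lp E p P} (hdom : ∀ n, ∀ᵐ ω ∂P, ‖η n ω - ξ ω‖ ≤ ‖ζ ω‖)
    (hlim : ∀ᵐ ω ∂P, Tendsto (fun n => η n ω) atTop (𝓝 (ξ ω))) : ξ ∈ A := by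
  rcases hp with rfl | ⟨hp, hp'⟩
  · by_contra hξ
    obtain ⟨ε, hε, h⟩ := isStronglyClosed_zero_iff.1 hA ξ hξ
    have hm : TendstoInMeasure P (fun n => (η n : Ω → E)) atTop ξ :=
      tendstoInMeasure_of_tendsto_ae (fun n => Lp.aestronglyMeasurable _) hlim
    rw [tendstoInMeasure_iff_norm] at hm
    obtain ⟨n, hn⟩ := ((hm ε hε).eventually_lt_const (ENNReal.ofReal_pos.2 hε)).exists
    exact h (η n) hn (hη n)
  · have : Fact (1 ≤ p) := ⟨hp⟩
    refine IsClosed.mem_of_tendsto (b := atTop) (f := η) (isStronglyClosed_iff_isClosed.1 hA) ?_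
      (Eventually.of_forall hη)
    rw [Lp.tendsto_Lp_iff_tendsto_eLpNorm']
    have hp0 : 0 < p.toReal := ENNReal.toReal_pos (by positivity) hp'
    have hint : Tendsto (fun n => ∫⁻ ω, ‖η n ω - ξ ω‖ₑ ^ p.toReal ∂P) atTop
        (𝓝 (∫⁻ _, 0 ∂P)) := by
      refine tendsto_lintegral_of_dominated_convergence' (fun ω => ‖ζ ω‖ₑ ^ p.toReal)
        (fun n => ?_) (fun n => ?_) ?_ ?_
      · exact ((Lp.aestronglyMeasurable _).sub (Lp.aestronglyMeasurable _)).enorm.pow_const _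
      · filter_upwards [hdom n] with ω hω
        exact ENNReal.rpow_le_rpow (enorm_le_iff_norm_le.2 hω) hp0.le
      · exact (lintegral_rpow_enorm_lt_top_of_eLpNorm_lt_top (by positivity) hp'
          (Lp.eLpNorm_lt_top ζ)).ne
      · filter_upwards [hlim] with ω hω
        have h1 : Tendsto (fun n => ‖η n ω - ξ ω‖ₑ) atTop (𝓝 0) := by
          have := (hω.sub_const (ξ ω)).enorm
          simpa using this
        simpa [ENNReal.zero_rpow_of_pos hp0] using h1.ennrpow_const p.toReal
    have h2 := hint.ennrpow_const (1 / p.toReal)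
    rw [lintegral_zero, ENNReal.zero_rpow_of_pos (by positivity)] at h2
    refine h2.congr fun n => ?_
    rw [eLpNorm_eq_lintegral_rpow_enorm_toReal (by positivity) hp']
    rfl

end StrongTopology

/-! ### Gluing and decomposable hulls. -/

section Decomposable

variable {Ω E : Type*} [MeasurableSpace Ω] [NormedAddCommGroup E] {P : Measure Ω} {p : ℝ≥0∞}

/-- The class of `1_B ξ + 1_{Bᶜ} ζ`. -/
noncomputable def glue (B : Set Ω) (hB : MeasurableSet B) (ξ ζ : Lp E p P) : Lp E p P :=
  ((Lp.memLp ξ).indicator hB).toLp + ((Lp.memLp ζ).indicator hB.compl).toLp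

theorem coeFn_glue {B : Set Ω} (hB : MeasurableSet B) (ξ ζ : Lp E p P) :
    ∀ᵐ ω ∂P, glue B hB ξ ζ ω = B.indicator ξ ω + Bᶜ.indicator ζ ω := by
  filter_upwards [Lp.coeFn_add ((Lp.memLp ξ).indicator hB).toLp
    ((Lp.memLp ζ).indicator hB.compl).toLp, ((Lp.memLp ξ).indicator hB).coeFn_toLp,
    ((Lp.memLp ζ).indicator hB.compl).coeFn_toLp] with ω h1 h2 h3
  rw [glue, h1, Pi.add_apply, h2, h3]

theorem glue_apply_cases {B : Set Ω} (hB : MeasurableSet B) (ξ ζ : Lp E p P) :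
    ∀ᵐ ω ∂P, (ω ∈ B → glue B hB ξ ζ ω = ξ ω) ∧ (ω ∉ B → glue B hB ξ ζ ω = ζ ω) := by
  filter_upwards [coeFn_glue hB ξ ζ] with ω h
  constructor <;> intro hω <;> simp [h, hω]

theorem IsDecomposable.glue_mem {A : Set (Lp E p P)} (hA : IsDecomposable A) {ξ ζ : Lp E p P}
    (hξ : ξ ∈ A) (hζ : ζ ∈ A) {B : Set Ω} (hB : MeasurableSet B) : glue B hB ξ ζ ∈ A :=
  hA ξ hξ ζ hζ B hB _ (coeFn_glue hB ξ ζ)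

theorem isDecomposable_of_glue_mem {A : Set (Lp E p P)}
    (h : ∀ ξ ∈ A, ∀ ζ ∈ A, ∀ (B : Set Ω) (hB : MeasurableSet B), glue B hB ξ ζ ∈ A) :
    IsDecomposable A := by
  intro ξ hξ ζ hζ B hB η hη
  have : η = glue B hB ξ ζ := by
    apply Lp.ext
    filter_upwards [hη, coeFn_glue hB ξ ζ] with ω h1 h2
    rw [h1, h2]
  exact this ▸ h ξ hξ ζ hζ B hB

theorem isDecomposable_decHull (A : Set (Lp E p P)) : IsDecomposable (decHull A) :=
  fun ξ hξ ζ hζ B hB η hη D hD => hD.1 ξ (hξ D hD) ζ (hζ D hD) B hB η hη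

theorem subset_decHull (A : Set (Lp E p P)) : A ⊆ decHull A :=
  fun _ hξ _ hD => hD.2 hξ

theorem decHull_subset {A D : Set (Lp E p P)} (hD : IsDecomposable D) (h : A ⊆ D) :
    decHull A ⊆ D :=
  Set.sInter_subset_of_mem ⟨hD, h⟩

/-- Gluing is pointwise nonexpansive in each argument separately, so one passes to the limit in one
argument at a time. -/
theorem IsDecomposable.strongClosure (hp : p = 0 ∨ 1 ≤ p) {A : Set (Lp E p P)}
    (hA : IsDecomposable A) : IsDecomposable (strongClosure A) := by
  have hleft : ∀ (B : Set Ω) (hB : MeasurableSet B) (ζ : Lp E p P),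
      IsStronglyClosed ((fun ξ => glue B hB ξ ζ) ⁻¹' ChoquetDecomposition.strongClosure A) := by
    refine fun B hB ζ =>
      (isStronglyClosed_strongClosure A).preimage_of_nonexpansive hp fun η ξ => ?_
    filter_upwards [glue_apply_cases hB η ζ, glue_apply_cases hB ξ ζ] with ω h1 h2
    by_cases hω : ω ∈ B
    · rw [h1.1 hω, h2.1 hω]
    · rw [h1.2 hω, h2.2 hω]; simp
  have hright : ∀ (B : Set Ω) (hB : MeasurableSet B) (ξ : Lp E p P),
      IsStronglyClosed ((fun ζ => glue B hB ξ ζ) ⁻¹' ChoquetDecomposition.strongClosure A) := by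
    refine fun B hB ξ =>
      (isStronglyClosed_strongClosure A).preimage_of_nonexpansive hp fun η ζ => ?_
    filter_upwards [glue_apply_cases hB ξ η, glue_apply_cases hB ξ ζ] with ω h1 h2
    by_cases hω : ω ∈ B
    · rw [h1.1 hω, h2.1 hω]; simp
    · rw [h1.2 hω, h2.2 hω]
  refine isDecomposable_of_glue_mem fun ξ hξ ζ hζ B hB => ?_
  refine strongClosure_subset (hright B hB ξ) (fun ζ' hζ' => ?_) hζ
  exact strongClosure_subset (hleft B hB ζ')
    (fun ξ' hξ' => subset_strongClosure A (hA.glue_mem hξ' hζ' hB)) hξ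

end Decomposable

/-! ### Measurable selection by reduction to compact sets in the plane. -/

section Selection

open ProbabilityTheory

variable {Ω E : Type*} [MeasurableSpace Ω] [MeasurableSpace E]

/-- A measurable subset of a product depends on its first variable through a real random
variable only. -/
theorem exists_real_factorization {G : Set (Ω × E)} (hG : MeasurableSet G) :
    ∃ f : Ω → ℝ, Measurable f ∧ ∃ H : Set (ℝ × E), MeasurableSet H ∧ Prod.map f id ⁻¹' H = G := by
  rw [← generateFrom_prod] at hG
  induction G, hG using MeasurableSpace.generateFrom_induction with
  | hC G hG _ =>
    obtain ⟨S, hS, T, hT, rfl⟩ := hG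
    refine ⟨S.indicator 1, measurable_one.indicator hS, {1} ×ˢ T,
      (measurableSet_singleton 1).prod hT, ?_⟩
    ext ⟨ω, x⟩
    by_cases hω : ω ∈ S <;> simp [hω]
  | empty => exact ⟨0, measurable_zero, ∅, MeasurableSet.empty, rfl⟩
  | compl G _ ih =>
    obtain ⟨f, hf, H, hH, rfl⟩ := ih
    exact ⟨f, hf, Hᶜ, hH.compl, rfl⟩
  | iUnion G _ ih =>
    choose f hf H hH hfH using ih
    -- The countably many real variables `f n` are coded into one; `r` is a measurable left inverse
    -- that decodes them.
    obtain ⟨e, he⟩ := exists_measurableEmbedding_real (ℕ → ℝ)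
    obtain ⟨r, hr, hre⟩ := he.exists_measurable_extend measurable_id fun _ => inferInstance
    refine ⟨fun ω => e fun n => f n ω, he.measurable.comp (measurable_pi_lambda _ hf),
      ⋃ n, Prod.map (fun t => r t n) id ⁻¹' H n, MeasurableSet.iUnion fun n =>
        (((measurable_pi_apply n).comp hr).prodMap measurable_id) (hH n), ?_⟩
    ext ⟨ω, x⟩
    have hr' : ∀ g, r (e g) = g := fun g => congrFun hre g
    simp only [← hfH, Set.mem_preimage, Set.mem_iUnion, Prod.map_apply, id_eq, hr']

/-- The lower envelope of a compact subset of the plane is a measurable selection. -/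
theorem measurable_sInf_section {C : Set (ℝ × ℝ)} (hC : IsCompact C) :
    Measurable fun t => sInf {z | (t, z) ∈ C} := by
  have hfib : ∀ t, IsCompact {z | (t, z) ∈ C} := fun t => by
    refine (hC.image continuous_snd).of_isClosed_subset
      (hC.isClosed.preimage (Continuous.prodMk_right t)) ?_
    exact fun z hz => ⟨(t, z), hz, rfl⟩
  refine measurable_of_Iic fun a => ?_
  have h1 : MeasurableSet (Prod.fst '' (C ∩ {q | q.2 ≤ a})) :=
    ((hC.inter_right (isClosed_le continuous_snd continuous_const)).image
      continuous_fst).measurableSet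
  have h2 : MeasurableSet (Prod.fst '' C) := (hC.image continuous_fst).measurableSet
  -- The second piece accounts for empty sections, where `sInf ∅ = 0`.
  have key : (fun t => sInf {z | (t, z) ∈ C}) ⁻¹' Set.Iic a =
      Prod.fst '' (C ∩ {q | q.2 ≤ a}) ∪ ((Prod.fst '' C)ᶜ ∩ {_t | 0 ≤ a}) := by
    ext t
    by_cases ht : ∃ z, (t, z) ∈ C
    · have hmem : (t, sInf {z | (t, z) ∈ C}) ∈ C := (hfib t).sInf_mem ht
      have hle : ∀ z, (t, z) ∈ C → sInf {z | (t, z) ∈ C} ≤ z := fun z hz =>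
        csInf_le (hfib t).bddBelow hz
      constructor
      · exact fun h => Or.inl ⟨_, ⟨hmem, h⟩, rfl⟩
      · rintro (⟨⟨_, z⟩, ⟨hz, hza⟩, rfl⟩ | ⟨h, -⟩)
        · exact (hle z hz).trans hza
        · exact absurd (Set.mem_image_of_mem Prod.fst hmem) h
    · have hempty : {z | (t, z) ∈ C} = ∅ := Set.eq_empty_of_forall_notMem fun z hz => ht ⟨z, hz⟩
      simp only [Set.mem_preimage, hempty, Real.sInf_empty, Set.mem_Iic]
      constructor
      · refine fun h => Or.inr ⟨?_, h⟩
        rintro ⟨⟨_, z⟩, hz, rfl⟩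
        exact ht ⟨z, hz⟩
      · rintro (⟨⟨_, z⟩, ⟨hz, -⟩, rfl⟩ | ⟨-, h⟩)
        · exact absurd ⟨z, hz⟩ ht
        · exact h
  rw [key]
  exact h1.union (h2.compl.inter (MeasurableSet.const _))

/-- A measurable set charged by a kernel has a measurable selection on a set of positive
measure. -/
theorem exists_measurable_selection_of_compProd_ne_zero [StandardBorelSpace E]
    {P : Measure Ω} [IsFiniteMeasure P] {K : Kernel Ω E} [IsMarkovKernel K]
    {G : Set (Ω × E)} (hG : MeasurableSet G) (hpos : (P ⊗ₘ K) G ≠ 0) :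
    ∃ S : Set Ω, MeasurableSet S ∧ P S ≠ 0 ∧ ∃ ξ : Ω → E, Measurable ξ ∧
      ∀ ω ∈ S, (ω, ξ ω) ∈ G := by
  obtain ⟨⟨_, x₀⟩, -⟩ := nonempty_of_measure_ne_zero hpos
  obtain ⟨f, hf, H, hH, rfl⟩ := exists_real_factorization hG
  obtain ⟨ι, hι⟩ := exists_measurableEmbedding_real E
  obtain ⟨r, hr, hrι⟩ := hι.exists_measurable_extend measurable_id fun _ => ⟨x₀⟩
  have hr' : ∀ x, r (ι x) = x := fun x => congrFun hrι x
  have hH' : MeasurableSet (Prod.map id ι '' H) :=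
    (MeasurableEmbedding.id.prodMap hι).measurableSet_image' hH
  have hfι : Measurable (Prod.map f ι) := hf.prodMap hι.measurable
  have hmap : 0 < (P ⊗ₘ K).map (Prod.map f ι) (Prod.map id ι '' H) := by
    rw [Measure.map_apply hfι hH']
    refine (pos_iff_ne_zero.2 hpos).trans_le (measure_mono ?_)
    exact fun q hq => ⟨_, hq, rfl⟩
  -- Inner regularity of the image measure on the plane: a compact part of the set still has
  -- positive mass, and its projection and lower envelope are measurable.
  obtain ⟨C, hCH, hC, hCpos⟩ := hH'.exists_lt_isCompact hmap
  have hproj : MeasurableSet (Prod.fst '' C) := (hC.image continuous_fst).measurableSet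
  refine ⟨f ⁻¹' (Prod.fst '' C), hf hproj, ?_, fun ω => r (sInf {z | (f ω, z) ∈ C}),
    hr.comp ((measurable_sInf_section hC).comp hf), ?_⟩
  · rw [Measure.map_apply hfι hC.measurableSet] at hCpos
    refine (hCpos.trans_le ?_).ne'
    calc (P ⊗ₘ K) (Prod.map f ι ⁻¹' C)
        ≤ (P ⊗ₘ K) (Prod.fst ⁻¹' (f ⁻¹' (Prod.fst '' C))) :=
          measure_mono fun q hq => ⟨_, hq, rfl⟩
      _ = P (f ⁻¹' (Prod.fst '' C)) := by
          rw [← Measure.fst_apply (hf hproj), Measure.fst_compProd]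
  · rintro ω ⟨⟨_, z⟩, hz, hzω⟩
    have hfib : IsCompact {z | (f ω, z) ∈ C} :=
      (hC.image continuous_snd).of_isClosed_subset
        (hC.isClosed.preimage (Continuous.prodMk_right _)) fun z hz => ⟨(_, z), hz, rfl⟩
    have hmem : (f ω, sInf {z | (f ω, z) ∈ C}) ∈ C := by
      refine hfib.sInf_mem ⟨z, ?_⟩
      rw [Set.mem_ofPred_eq, ← hzω]
      exact hz
    obtain ⟨⟨t, x⟩, hx, hxe⟩ := hCH hmem
    simp only [Prod.map_apply, id_eq, Prod.mk.injEq] at hxe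
    obtain ⟨rfl, hxe⟩ := hxe
    simpa only [Set.mem_preimage, Prod.map_apply, id_eq, ← hxe, hr'] using hx

end Selection

/-! ### Castaing representation of closed decomposable sets. -/

section Castaing

variable {Ω E : Type*} [MeasurableSpace Ω] [NormedAddCommGroup E] {P : Measure Ω} {p : ℝ≥0∞}

theorem measurableSet_norm_sub_lt_norm_sub (ξ ζ η : Lp E p P) :
    MeasurableSet {ω | ‖ξ ω - η ω‖ < ‖ζ ω - η ω‖} :=
  measurableSet_lt ((Lp.stronglyMeasurable ξ).sub (Lp.stronglyMeasurable η)).norm.measurable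
    ((Lp.stronglyMeasurable ζ).sub (Lp.stronglyMeasurable η)).norm.measurable

/-- The successive best approximations of `η` by pointwise choices among `ξ 0, …, ξ n`. -/
noncomputable def nearest (ξ : ℕ → Lp E p P) (η : Lp E p P) : ℕ → Lp E p P
  | 0 => ξ 0
  | n + 1 => glue _ (measurableSet_norm_sub_lt_norm_sub (ξ (n + 1)) (nearest ξ η n) η)
      (ξ (n + 1)) (nearest ξ η n)

theorem IsDecomposable.nearest_mem {A : Set (Lp E p P)} (hA : IsDecomposable A)
    {ξ : ℕ → Lp E p P} (hξ : ∀ n, ξ n ∈ A) (η : Lp E p P) (n : ℕ) : nearest ξ η n ∈ A := by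
  induction n with
  | zero => exact hξ 0
  | succ n ih => exact hA.glue_mem (hξ _) ih _

theorem norm_nearest_sub_le (ξ : ℕ → Lp E p P) (η : Lp E p P) :
    ∀ᵐ ω ∂P, ∀ n, ∀ k ≤ n, ‖nearest ξ η n ω - η ω‖ ≤ ‖ξ k ω - η ω‖ := by
  have h := ae_all_iff.2 fun n => glue_apply_cases
    (measurableSet_norm_sub_lt_norm_sub (ξ (n + 1)) (nearest ξ η n) η) (ξ (n + 1)) (nearest ξ η n)
  filter_upwards [h] with ω hω n
  induction n with
  | zero =>
    intro k hk
    rw [Nat.le_zero.1 hk]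
    exact le_rfl
  | succ n ih =>
    have hstep : ‖nearest ξ η (n + 1) ω - η ω‖ ≤ ‖ξ (n + 1) ω - η ω‖ ∧
        ‖nearest ξ η (n + 1) ω - η ω‖ ≤ ‖nearest ξ η n ω - η ω‖ := by
      by_cases hlt : ‖ξ (n + 1) ω - η ω‖ < ‖nearest ξ η n ω - η ω‖
      · rw [nearest, (hω n).1 hlt]
        exact ⟨le_rfl, hlt.le⟩
      · rw [nearest, (hω n).2 hlt]
        exact ⟨not_lt.1 hlt, le_rfl⟩
    intro k hk
    rcases Nat.lt_or_eq_of_le hk with hk | rfl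
    · exact hstep.2.trans (ih k (Nat.lt_succ_iff.1 hk))
    · exact hstep.1

theorem tendsto_nearest (ξ : ℕ → Lp E p P) {η : Lp E p P}
    (hη : η ∈ selections p P fun ω => closure (Set.range fun n => ξ n ω)) :
    ∀ᵐ ω ∂P, Tendsto (fun n => nearest ξ η n ω) atTop (𝓝 (η ω)) := by
  filter_upwards [hη, norm_nearest_sub_le ξ η] with ω h1 h2
  rw [Metric.tendsto_atTop]
  intro ε hε
  obtain ⟨_, ⟨k, rfl⟩, hk⟩ := Metric.mem_closure_iff.1 h1 ε hε
  refine ⟨k, fun n hn => ?_⟩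
  rw [dist_eq_norm]
  refine (h2 n k hn).trans_lt ?_
  rwa [← dist_eq_norm, dist_comm]

/-- The approximations `nearest ξ η n` stay in `A` and converge to `η` almost surely, and their
errors never exceed that of the first one, `ξ 0`, which provides the dominating function. -/
theorem selections_closure_range_subset [IsFiniteMeasure P] (hp : p = 0 ∨ (1 ≤ p ∧ p ≠ ∞))
    {A : Set (Lp E p P)} (hA : IsDecomposable A) (hA' : IsStronglyClosed A)
    {ξ : ℕ → Lp E p P} (hξ : ∀ n, ξ n ∈ A) :
    selections p P (fun ω => closure (Set.range fun n => ξ n ω)) ⊆ A := by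
  intro η hη
  refine hA'.mem_of_dominated hp (hA.nearest_mem hξ η) (ζ := ξ 0 - η) (fun n => ?_)
    (tendsto_nearest ξ hη)
  filter_upwards [norm_nearest_sub_le ξ η, Lp.coeFn_sub (ξ 0) η] with ω h1 h2
  rw [h2]
  exact h1 n 0 n.zero_le

/-- Truncating at `1` gives a distance functional that is finite even for `p = 0`. -/
theorem integrable_min_norm_sub_one [IsFiniteMeasure P] (ξ : Lp E p P) (x : E) :
    Integrable (fun ω => min ‖ξ ω - x‖ 1) P := by
  refine Integrable.of_bound (C := 1) ?_ (Eventually.of_forall fun ω => ?_)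
  · exact (((Lp.aestronglyMeasurable ξ).sub aestronglyMeasurable_const).norm.inf
      aestronglyMeasurable_const)
  · rw [Real.norm_of_nonneg (by positivity)]
    exact min_le_right _ _

/-- In a decomposable set, a sequence minimising a truncated distance to the point `x` comes
pointwise nearly as close to `x` as any other member of the set. -/
theorem IsDecomposable.exists_seq_near [IsFiniteMeasure P] {A : Set (Lp E p P)}
    (hA : IsDecomposable A) (hne : A.Nonempty) (x : E) :
    ∃ ξ : ℕ → Lp E p P, (∀ n, ξ n ∈ A) ∧ ∀ η ∈ A, ∀ ε : ℝ, 0 < ε → ε ≤ 1 / 2 →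
      ∀ᵐ ω ∂P, ‖η ω - x‖ < ε → ∃ n, ‖ξ n ω - x‖ < 2 * ε := by
  set J : Lp E p P → ℝ := fun ξ => ∫ ω, min ‖ξ ω - x‖ 1 ∂P with hJ
  have hbdd : BddBelow (J '' A) := by
    refine ⟨0, ?_⟩
    rintro _ ⟨ξ, -, rfl⟩
    exact integral_nonneg fun ω => by positivity
  obtain ⟨u, -, hu, huA⟩ := exists_seq_tendsto_sInf (hne.image J) hbdd
  choose ξ hξA hξu using huA
  refine ⟨ξ, hξA, fun η hη ε hε hε' => ?_⟩
  set S : Set Ω := {ω | ‖η ω - x‖ < ε} ∩ ⋂ n, {ω | 2 * ε ≤ ‖ξ n ω - x‖} with hS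
  have hSm : MeasurableSet S := by
    refine (measurableSet_lt ?_ measurable_const).inter (MeasurableSet.iInter fun n =>
      measurableSet_le measurable_const ?_)
    · exact ((Lp.stronglyMeasurable η).sub stronglyMeasurable_const).norm.measurable
    · exact ((Lp.stronglyMeasurable (ξ n)).sub stronglyMeasurable_const).norm.measurable
  -- Replacing `ξ n` by `η` on `S` lowers the functional by at least `ε` times the measure of `S`;
  -- `ε ≤ 1 / 2` keeps `2 * ε` below the truncation level. A minimising sequence therefore forces
  -- `S` to be null.
  have hle : ∀ n, sInf (J '' A) ≤ u n - P.real S * ε := by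
    intro n
    refine (csInf_le hbdd ⟨_, hA.glue_mem hη (hξA n) hSm, rfl⟩).trans ?_
    rw [← hξu n, ← smul_eq_mul, ← integral_indicator_const ε hSm, hJ,
      ← integral_sub (integrable_min_norm_sub_one _ _) ((integrable_const ε).indicator hSm)]
    refine integral_mono_ae (integrable_min_norm_sub_one _ _)
      ((integrable_min_norm_sub_one _ _).sub ((integrable_const ε).indicator hSm)) ?_
    filter_upwards [glue_apply_cases hSm η (ξ n)] with ω hω
    by_cases h : ω ∈ S
    · have h2 : 2 * ε ≤ ‖ξ n ω - x‖ := Set.mem_iInter.1 h.2 n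
      have h3 : 2 * ε ≤ min ‖ξ n ω - x‖ 1 := le_min h2 (by linarith)
      have h4 : min ‖η ω - x‖ 1 ≤ ε := (min_le_left _ _).trans h.1.le
      simp only [hω.1 h, Set.indicator_of_mem h]
      linarith
    · simp [hω.2 h, h]
  have hlim : sInf (J '' A) ≤ sInf (J '' A) - P.real S * ε :=
    ge_of_tendsto' (hu.sub_const _) hle
  have hzero : P.real S = 0 := by
    have : P.real S * ε ≤ 0 := by linarith
    exact le_antisymm (nonpos_of_mul_nonpos_left this hε) measureReal_nonneg
  have hzero' : P S = 0 := (measureReal_eq_zero_iff).1 hzero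
  filter_upwards [measure_eq_zero_iff_ae_notMem.1 hzero'] with ω hω h
  by_contra! hcon
  exact hω ⟨h, Set.mem_iInter.2 hcon⟩

/-- A decomposable strongly closed set consists of the selections of a multifunction with a
Castaing representation made of members of the set. -/
theorem IsDecomposable.exists_castaing [TopologicalSpace.SeparableSpace E] [IsFiniteMeasure P]
    (hp : p = 0 ∨ (1 ≤ p ∧ p ≠ ∞)) {A : Set (Lp E p P)} (hA : IsDecomposable A)
    (hA' : IsStronglyClosed A) (hne : A.Nonempty) :
    ∃ ξ : ℕ → Lp E p P, (∀ n, ξ n ∈ A) ∧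
      A = selections p P fun ω => closure (Set.range fun n => ξ n ω) := by
  choose ξ hξA hξ using fun i => hA.exists_seq_near hne (TopologicalSpace.denseSeq E i)
  refine ⟨fun n => ξ n.unpair.1 n.unpair.2, fun n => hξA _ _, ?_⟩
  refine Set.Subset.antisymm (fun η hη => ?_)
    (selections_closure_range_subset hp hA hA' fun n => hξA _ _)
  have h : ∀ᵐ ω ∂P, ∀ i m : ℕ, ‖η ω - TopologicalSpace.denseSeq E i‖ < 1 / ((m : ℝ) + 1) / 2 →
      ∃ n, ‖ξ i n ω - TopologicalSpace.denseSeq E i‖ < 2 * (1 / ((m : ℝ) + 1) / 2) := by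
    refine ae_all_iff.2 fun i => ae_all_iff.2 fun m => hξ i η hη _ (by positivity) ?_
    have : 1 / ((m : ℝ) + 1) ≤ 1 := by
      rw [div_le_one (by positivity)]
      linarith [(Nat.cast_nonneg m : (0 : ℝ) ≤ m)]
    linarith
  filter_upwards [h] with ω hω
  refine Metric.mem_closure_iff.2 fun ε hε => ?_
  obtain ⟨m, hm⟩ := exists_nat_one_div_lt (half_pos hε)
  obtain ⟨i, hi⟩ := (TopologicalSpace.denseRange_denseSeq E).exists_dist_lt (η ω)
    (show 0 < 1 / ((m : ℝ) + 1) / 2 by positivity)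
  rw [dist_eq_norm] at hi
  obtain ⟨n, hn⟩ := hω i m hi
  refine ⟨_, ⟨Nat.pair i n, rfl⟩, ?_⟩
  simp only [Nat.unpair_pair]
  rw [← dist_eq_norm] at hi hn
  have := dist_triangle_right (η ω) (ξ i n ω) (TopologicalSpace.denseSeq E i)
  linarith

theorem isClosedRandomSet_closure_range [TopologicalSpace.SeparableSpace E] [MeasurableSpace E]
    [BorelSpace E] (ξ : ℕ → Lp E p P) :
    IsClosedRandomSet P fun ω => closure (Set.range fun n => ξ n ω) := by
  refine ⟨?_, Eventually.of_forall fun ω => isClosed_closure⟩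
  have : SecondCountableTopology E := UniformSpace.secondCountable_of_separable E
  have key : {z : Ω × E | z.2 ∈ closure (Set.range fun n => ξ n z.1)} =
      ⋂ m : ℕ, ⋃ n : ℕ, {z | dist z.2 (ξ n z.1) < 1 / ((m : ℝ) + 1)} := by
    ext z
    simp only [Metric.mem_closure_range_iff_nat, Set.mem_iInter, Set.mem_iUnion, Set.mem_ofPred_eq]
  rw [key]
  exact MeasurableSet.iInter fun m => MeasurableSet.iUnion fun n =>
    measurableSet_lt (measurable_snd.dist ((Lp.stronglyMeasurable (ξ n)).measurable.comp
      measurable_fst)) measurable_const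

end Castaing

/-! ### Two-point kernels. -/

section DiracMix

open ProbabilityTheory

variable {Ω E : Type*} [MeasurableSpace Ω] [MeasurableSpace E]

/-- The kernel `a δ_ξ + b δ_ζ`. -/
noncomputable def diracMix (a b : ℝ) {ξ ζ : Ω → E} (hξ : Measurable ξ) (hζ : Measurable ζ) :
    Kernel Ω E where
  toFun ω := ENNReal.ofReal a • Measure.dirac (ξ ω) + ENNReal.ofReal b • Measure.dirac (ζ ω)
  measurable' := by
    refine Measure.measurable_of_measurable_coe _ fun s hs => ?_
    simp only [Measure.coe_add, Measure.coe_smul, Pi.add_apply, Pi.smul_apply, smul_eq_mul,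
      Measure.dirac_apply' _ hs]
    exact ((((measurable_one.indicator hs).comp hξ).const_mul _).add
      (((measurable_one.indicator hs).comp hζ).const_mul _))

theorem diracMix_apply {a b : ℝ} {ξ ζ : Ω → E} (hξ : Measurable ξ) (hζ : Measurable ζ) (ω : Ω) :
    diracMix a b hξ hζ ω =
      ENNReal.ofReal a • Measure.dirac (ξ ω) + ENNReal.ofReal b • Measure.dirac (ζ ω) :=
  rfl

theorem diracMix_apply_of_mem {a b : ℝ} (ha : 0 ≤ a) (hb : 0 ≤ b) (hab : a + b = 1)
    {ξ ζ : Ω → E} (hξ : Measurable ξ) (hζ : Measurable ζ) {ω : Ω} {C : Set E}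
    (h1 : ξ ω ∈ C) (h2 : ζ ω ∈ C) : diracMix a b hξ hζ ω C = 1 := by
  rw [diracMix_apply, Measure.add_apply, Measure.smul_apply, Measure.smul_apply,
    Measure.dirac_apply_of_mem h1, Measure.dirac_apply_of_mem h2, smul_eq_mul, smul_eq_mul,
    mul_one, mul_one, ← ENNReal.ofReal_add ha hb, hab, ENNReal.ofReal_one]

end DiracMix

/-! ### Barycenters, carriers of kernels and the two implications. -/

section Barycenter

open ProbabilityTheory

variable {Ω E : Type*} [MeasurableSpace Ω] [NormedAddCommGroup E] {P : Measure Ω} {p : ℝ≥0∞}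

/-- The barycenter of a probability measure carried by a closed convex set lies in that set. -/
theorem IsBarycenter.mem_of_ae_mem [NormedSpace ℝ E] [MeasurableSpace E]
    {μ : Measure E} [IsProbabilityMeasure μ] {y : E}
    (hy : IsBarycenter μ y) {C : Set E} (hC : Convex ℝ C) (hC' : IsClosed C)
    (hμ : ∀ᵐ x ∂μ, x ∈ C) : y ∈ C := by
  by_contra hyC
  obtain ⟨L, u, hL, hu⟩ := geometric_hahn_banach_closed_point hC hC' hyC
  obtain ⟨hint, hLy⟩ := hy L
  have h : ∫ x, L x ∂μ ≤ ∫ _, u ∂μ :=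
    integral_mono_ae hint (integrable_const u) (hμ.mono fun x hx => (hL x hx).le)
  rw [integral_const, probReal_univ, one_smul, ← hLy] at h
  exact absurd h (not_le.2 hu)

theorem isBarycenter_smul_dirac_add_smul_dirac [NormedSpace ℝ E] [MeasurableSpace E] [BorelSpace E]
    {a b : ℝ} (ha : 0 ≤ a) (hb : 0 ≤ b) (x y : E) :
    IsBarycenter (ENNReal.ofReal a • Measure.dirac x + ENNReal.ofReal b • Measure.dirac y)
      (a • x + b • y) := by
  intro L
  have hx : Integrable (fun x => L x) (ENNReal.ofReal a • Measure.dirac x) :=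
    (integrable_dirac (by simp)).smul_measure ENNReal.ofReal_ne_top
  have hy : Integrable (fun x => L x) (ENNReal.ofReal b • Measure.dirac y) :=
    (integrable_dirac (by simp)).smul_measure ENNReal.ofReal_ne_top
  refine ⟨hx.add_measure hy, ?_⟩
  rw [integral_add_measure hx hy, integral_smul_measure, integral_smul_measure, integral_dirac,
    integral_dirac, ENNReal.toReal_ofReal ha, ENNReal.toReal_ofReal hb, map_add, map_smul, map_smul]

/-- Taking selections of `F`, not just members of `A`, is what later yields `cl_p (dec A) ⊆ A`. -/
theorem IsChoquetConvexDecomposable.smul_add_smul_mem [NormedSpace ℝ E] [MeasurableSpace E]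
    [BorelSpace E]
    [TopologicalSpace.SeparableSpace E] {A : Set (Lp E p P)} (hA : IsChoquetConvexDecomposable A)
    {F : Ω → Set E} (hF : IsDecRandomSet A F) {ξ ζ : Lp E p P} (hξ : ξ ∈ selections p P F)
    (hζ : ζ ∈ selections p P F) {a b : ℝ} (ha : 0 ≤ a) (hb : 0 ≤ b) (hab : a + b = 1) :
    a • ξ + b • ζ ∈ A := by
  have hξm : Measurable ξ := (Lp.stronglyMeasurable ξ).measurable
  have hζm : Measurable ζ := (Lp.stronglyMeasurable ζ).measurable
  have hbar : IsKernelBarycenter (diracMix a b hξm hζm) (a • ξ + b • ζ) := by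
    filter_upwards [Lp.coeFn_add (a • ξ) (b • ζ), Lp.coeFn_smul a ξ, Lp.coeFn_smul b ζ]
      with ω h1 h2 h3
    rw [h1, Pi.add_apply, h2, h3]
    exact isBarycenter_smul_dirac_add_smul_dirac ha hb _ _
  refine hA _ ⟨diracMix a b hξm hζm, ⟨⟨fun ω => ⟨?_⟩⟩, ⟨F, hF, ?_⟩, _, hbar⟩, hbar⟩
  · exact diracMix_apply_of_mem ha hb hab hξm hζm (Set.mem_univ _) (Set.mem_univ _)
  · filter_upwards [hξ, hζ] with ω h1 h2
    exact diracMix_apply_of_mem ha hb hab hξm hζm h1 h2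

theorem exists_isDecRandomSet [MeasurableSpace E] [BorelSpace E]
    [TopologicalSpace.SeparableSpace E] [IsFiniteMeasure P]
    (hp : p = 0 ∨ (1 ≤ p ∧ p ≠ ∞)) {A : Set (Lp E p P)} (hA : A.Nonempty) :
    ∃ F : Ω → Set E, IsDecRandomSet A F := by
  obtain ⟨ξ, -, h⟩ :=
    ((isDecomposable_decHull A).strongClosure (hp.imp_right And.left)).exists_castaing hp
      (isStronglyClosed_strongClosure _)
      (hA.mono ((subset_decHull A).trans (subset_strongClosure _)))
  exact ⟨_, isClosedRandomSet_closure_range ξ, h⟩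

/-- If every selection of `F` is a selection of `F'`, then a kernel carried by `F` is carried
by `F'`. -/
theorem ae_ae_mem_of_selections_subset [MeasurableSpace E] [BorelSpace E]
    [CompleteSpace E] [TopologicalSpace.SeparableSpace E]
    [IsFiniteMeasure P] {K : Kernel Ω E} [IsMarkovKernel K] {F F' : Ω → Set E}
    (hF : MeasurableSet {z : Ω × E | z.2 ∈ F z.1})
    (hF' : MeasurableSet {z : Ω × E | z.2 ∈ F' z.1})
    (hne : (selections p P F).Nonempty) (hsub : selections p P F ⊆ selections p P F')
    (hK : ∀ᵐ ω ∂P, K ω (F ω) = 1) : ∀ᵐ ω ∂P, ∀ᵐ x ∂(K ω), x ∈ F' ω := by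
  have : SecondCountableTopology E := UniformSpace.secondCountable_of_separable E
  have hnull : (P ⊗ₘ K) ({z | z.2 ∈ F z.1} \ {z | z.2 ∈ F' z.1}) = 0 := by
    by_contra hpos
    obtain ⟨S, hS, hPS, ζ, hζ, hζS⟩ :=
      exists_measurable_selection_of_compProd_ne_zero (hF.diff hF') hpos
    obtain ⟨ξ₀, hξ₀⟩ := hne
    refine hPS ?_
    -- `ζ` need not be `p`-integrable; on each piece it is bounded, and `ξ₀` completes it to an
    -- element of `L^p(F)`.
    have hcover : S = ⋃ N : ℕ, S ∩ {ω | ‖ζ ω‖ ≤ N} := by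
      ext ω
      simp only [Set.mem_iUnion, Set.mem_inter_iff, Set.mem_ofPred_eq, exists_and_left,
        exists_nat_ge, and_true]
    rw [hcover]
    refine measure_iUnion_null fun N => ?_
    have hSN : MeasurableSet (S ∩ {ω | ‖ζ ω‖ ≤ N}) :=
      hS.inter (measurableSet_le hζ.norm measurable_const)
    have hmem : MemLp ((S ∩ {ω | ‖ζ ω‖ ≤ N}).indicator ζ) p P := by
      refine MemLp.of_bound (hζ.indicator hSN).aestronglyMeasurable N
        (Eventually.of_forall fun ω => ?_)
      by_cases hω : ω ∈ S ∩ {ω | ‖ζ ω‖ ≤ N}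
      · rw [Set.indicator_of_mem hω]
        exact hω.2
      · simp [hω]
    have hglue : ∀ᵐ ω ∂P, (ω ∈ S ∩ {ω | ‖ζ ω‖ ≤ N} → glue _ hSN hmem.toLp ξ₀ ω = ζ ω) ∧
        (ω ∉ S ∩ {ω | ‖ζ ω‖ ≤ N} → glue _ hSN hmem.toLp ξ₀ ω = ξ₀ ω) := by
      filter_upwards [glue_apply_cases hSN hmem.toLp ξ₀, hmem.coeFn_toLp] with ω h1 h2
      refine ⟨fun h => ?_, h1.2⟩
      rw [h1.1 h, h2, Set.indicator_of_mem h]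
    have hsel : glue _ hSN hmem.toLp ξ₀ ∈ selections p P F := by
      change ∀ᵐ ω ∂P, _ ∈ F ω
      filter_upwards [hglue, hξ₀] with ω h1 h2
      by_cases hω : ω ∈ S ∩ {ω | ‖ζ ω‖ ≤ N}
      · rw [h1.1 hω]
        exact (hζS ω hω.1).1
      · rwa [h1.2 hω]
    rw [measure_eq_zero_iff_ae_notMem]
    filter_upwards [hglue, hsub hsel] with ω h1 h2 hω
    rw [h1.1 hω] at h2
    exact (hζS ω hω.1).2 h2
  filter_upwards [Measure.ae_ae_of_ae_compProd (measure_eq_zero_iff_ae_notMem.1 hnull), hK]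
    with ω h1 h2
  have hFω : ∀ᵐ x ∂(K ω), x ∈ F ω :=
    (prob_compl_eq_zero_iff (measurable_prodMk_left hF)).2 h2
  filter_upwards [hFω, h1] with x h3 h4
  by_contra h5
  exact h4 ⟨h3, h5⟩

/-- If the set of selections of `ω ↦ closure {ξ n ω}` is convex, then so is almost every value of
this multifunction. -/
theorem ae_convex_closure_range [NormedSpace ℝ E] {ξ : ℕ → Lp E p P}
    (hξ : ∀ n, ξ n ∈ selections p P fun ω => closure (Set.range fun n => ξ n ω))
    (hconv : Convex ℝ (selections p P fun ω => closure (Set.range fun n => ξ n ω))) :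
    ∀ᵐ ω ∂P, Convex ℝ (closure (Set.range fun n => ξ n ω)) := by
  -- Only countably many weights and pairs are tested, so one null set suffices; continuity recovers
  -- all weights and all points of the closure.
  have h : ∀ᵐ ω ∂P, ∀ i j k : ℕ, (TopologicalSpace.denseSeq unitInterval k : ℝ) • ξ i ω +
      (1 - (TopologicalSpace.denseSeq unitInterval k : ℝ)) • ξ j ω ∈
        closure (Set.range fun n => ξ n ω) := by
    refine ae_all_iff.2 fun i => ae_all_iff.2 fun j => ae_all_iff.2 fun k => ?_
    set t := TopologicalSpace.denseSeq unitInterval k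
    have hmem := hconv (hξ i) (hξ j) t.2.1 (sub_nonneg.2 t.2.2) (add_sub_cancel _ _)
    filter_upwards [hmem, Lp.coeFn_add ((t : ℝ) • ξ i) ((1 - (t : ℝ)) • ξ j),
      Lp.coeFn_smul (t : ℝ) (ξ i), Lp.coeFn_smul (1 - (t : ℝ)) (ξ j)] with ω h1 h2 h3 h4
    rwa [h2, Pi.add_apply, h3, h4] at h1
  filter_upwards [h] with ω hω
  have hseg : ∀ (i j : ℕ) (t : unitInterval), (t : ℝ) • ξ i ω + (1 - (t : ℝ)) • ξ j ω ∈
      closure (Set.range fun n => ξ n ω) := fun i j t =>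
    (TopologicalSpace.denseRange_denseSeq unitInterval).induction_on t
      (isClosed_closure.preimage (by fun_prop)) (hω i j)
  intro x hx y hy a b ha hb hab
  obtain rfl : b = 1 - a := by linarith
  rw [← closure_closure]
  refine map_mem_closure₂ (f := fun x y => a • x + (1 - a) • y) (by fun_prop) hx hy ?_
  rintro _ ⟨i, rfl⟩ _ ⟨j, rfl⟩
  exact hseg i j ⟨a, ha, by linarith⟩

theorem isChoquetConvexDecomposable_of_convex [NormedSpace ℝ E] [MeasurableSpace E] [BorelSpace E]
    [CompleteSpace E]
    [TopologicalSpace.SeparableSpace E] [IsFiniteMeasure P] (hp : p = 0 ∨ (1 ≤ p ∧ p ≠ ∞))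
    {A : Set (Lp E p P)} (hne : A.Nonempty) (hconv : Convex ℝ A) (hdec : IsDecomposable A)
    (hcl : IsStronglyClosed A) : IsChoquetConvexDecomposable A := by
  rintro Y ⟨K, ⟨hK, ⟨F, ⟨hF, hAF⟩, hKF⟩, -⟩, hY⟩
  have hA : strongClosure (decHull A) = A :=
    (strongClosure_subset hcl (decHull_subset hdec subset_rfl)).antisymm
      ((subset_decHull A).trans (subset_strongClosure _))
  rw [hA] at hAF
  obtain ⟨ξ, hξ, hAξ⟩ := hdec.exists_castaing hp hcl hne
  have hcarried := ae_ae_mem_of_selections_subset hF.measurableSet_graph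
    (isClosedRandomSet_closure_range ξ).measurableSet_graph (hAF ▸ hne) (hAF ▸ hAξ.subset) hKF
  have hconvex := ae_convex_closure_range (fun n => hAξ ▸ hξ n) (hAξ ▸ hconv)
  rw [hAξ]
  filter_upwards [hcarried, hconvex, hY] with ω h1 h2 h3
  exact h3.mem_of_ae_mem h2 isClosed_closure h1

end Barycenter

end ChoquetDecomposition

theorem corollary7p4 {Ω E : Type*} [MeasurableSpace Ω] (P : Measure Ω) [IsProbabilityMeasure P]
    [P.IsComplete] [NormedAddCommGroup E] [NormedSpace ℝ E] [CompleteSpace E]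
    [TopologicalSpace.SeparableSpace E] [MeasurableSpace E] [BorelSpace E]
    (p : ℝ≥0∞) (hp : p = 0 ∨ (1 ≤ p ∧ p ≠ ∞))
    (A : Set (Lp E p P)) (hA : A.Nonempty) :
    ChoquetDecomposition.IsChoquetConvexDecomposable A ↔
      (Convex ℝ A ∧ ChoquetDecomposition.IsDecomposable A ∧
        ChoquetDecomposition.IsStronglyClosed A) := by
  open ChoquetDecomposition in
  refine ⟨fun h => ?_, fun ⟨hconv, hdec, hcl⟩ =>
    isChoquetConvexDecomposable_of_convex hp hA hconv hdec hcl⟩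
  obtain ⟨F, hF⟩ := exists_isDecRandomSet hp hA
  have hsub : A ⊆ selections p P F :=
    ((subset_decHull A).trans (subset_strongClosure _)).trans hF.2.subset
  have hAeq : strongClosure (decHull A) = A := by
    refine Set.Subset.antisymm (fun Y hY => ?_)
      ((subset_decHull A).trans (subset_strongClosure _))
    have hY' := hF.2.subset hY
    -- The weights `1` and `0` turn the mixture into the Dirac kernel at `Y`.
    simpa using h.smul_add_smul_mem hF hY' hY' zero_le_one le_rfl (add_zero 1)
  refine ⟨fun ξ hξ ζ hζ a b ha hb hab =>
    h.smul_add_smul_mem hF (hsub hξ) (hsub hζ) ha hb hab, ?_, ?_⟩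
  · exact hAeq ▸ (isDecomposable_decHull A).strongClosure (hp.imp_right And.left)
  · exact hAeq ▸ isStronglyClosed_strongClosure (decHull A)
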